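/- Let $N,d\ge 1$, $\Omega_1=\{x\in\mathbb R^N: x_N>0\}$, $\Omega_2=\{x_N<0\}$, $\mathcal H=\{x_N=0\}$, and let $e_N$ be the last unit vector. Let $A_1,A_2\subset\mathbb R^d$ be closed and convex and, for $i=1,2$, let $A_i^1\subset A_i^2\subset\cdots$ be compact sets with $\bigcup_{m\ge1}A_i^m=A_i$. Let $b_i:\overline{\Omega_i}\times A_i\to\mathbb R^N$ and $l_i:\overline{\Omega_i}\times A_i\to\mathbb R$ satisfy, for $i=1,2$: * (HA) $b_i$ and $l_i$ are continuous, and $b_i$ is Lipschitz in $\alpha_i$, uniformly for $x$ in compact subsets of $\overline{\Omega_i}$; * (HB) for all $x\in\overline{\Omega_i}$ and $m\ge1$ the set $\{b_i(x,\alpha_i):\alpha_i\in A_i^m\}$ is closed and convex and contains a ball $\overline{B_\delta(0)}$ with $\delta>0$ (possibly depending on $x$, $m$ and $i$); * (HC) $|b_i(x,\alpha_i)|\to+\infty$ and $l_i(x,\alpha_i)/(1+|b_i(x,\alpha_i)|)\to+\infty$ as $|\alpha_i|\to\infty$, $\alpha_i\in A_i$, uniformly for $x$ in compact subsets of $\overline{\Omega_i}$.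 Fix $m\ge 1$ and $T>0$ and put $A^m=A_1^m\times A_2^m\times[0,1]$. For $x\in\mathcal H$ and $a=(\alpha_1,\alpha_2,\mu)$ let $b_{\mathcal H}(x,a)=\mu b_1(x,\alpha_1)+(1-\mu)b_2(x,\alpha_2)$. Let $\tau_{A^m}(x)$ be the set of pairs $(X,a)$ of a Lipschitz function $X:[0,T]\to\mathbb R^N$ with $X(0)=x$ and a control $a=(\alpha_1,\alpha_2,\mu)\in L^\infty((0,T);A^m)$ such that for a.e. $t\in(0,T)$ $$\dot X(t)=b_1(X(t),\alpha_1(t))\mathbf 1_{\{X(t)\in\Omega_1\}}+b_2(X(t),\alpha_2(t))\mathbf 1_{\{X(t)\in\Omega_2\}}+b_{\mathcal H}(X(t),a(t))\mathbf 1_{\{X(t)\in\mathcal H\}}.$$ For $\eta>0$ let $\tau^\eta_{A^m}(x)$ be the set of $(X,a)\in\tau_{A^m}(x)$ such that $b_1(X(t),\alpha_1(t))\cdot e_N\le\eta$ and $b_2(X(t),\alpha_2(t))\cdot e_N\ge-\eta$ for a.e. $t$ with $X(t)\in\mathcal H$. Let $\tau^{\rm reg}_{A^m}(x)$ be the set of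 $(X,a)\in\tau_{A^m}(x)$ such that, for a.e. $t$ with $X(t)\in\mathcal H$, the control $a(t)$ is regular at $X(t)$, i.e. $b_{\mathcal H}(X(t),a(t))\cdot e_N=0$, $b_1(X(t),\alpha_1(t))\cdot e_N\le0$ and $b_2(X(t),\alpha_2(t))\cdot e_N\ge0$. **Lemma.** Let $\eta_n>0$, $\eta_n\to0$, and let $(X^n,\alpha^n)\in\tau^{\eta_n}_{A^m}(x_n)$ for some $x_n\in\mathbb R^N$, $n\in\mathbb N$. Suppose that $X^n\to X$ uniformly on $[0,T]$, where $X$ is an admissible trajectory: $(X,\alpha)\in\tau_{A^m}(x)$ for some control $\alpha$ and some $x\in\mathbb R^N$. Then $X$ is regular: there is a control $a$ with $(X,a)\in\tau^{\rm reg}_{A^m}(x)$. -/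

import Mathlib

open Set Filter Topology MeasureTheory

namespace TwoDomain

/-- The state space `ℝ^N`, written with `N = k + 1` so that there is a last coordinate. -/
abbrev State (k : ℕ) : Type := EuclideanSpace ℝ (Fin (k + 1))

/-- The space `ℝ^d` that contains the control sets `A₁, A₂`. -/
abbrev Ctrl (d : ℕ) : Type := EuclideanSpace ℝ (Fin d)

/-- The space of extended controls `a = (α₁, α₂, μ)`. -/
abbrev ExtCtrl (d : ℕ) : Type := Ctrl d × Ctrl d × ℝ

/-- The last coordinate `x_N = x · e_N`. -/
def lastCoord {k : ℕ} (x : State k) : ℝ := x (Fin.last k)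

/-- The hyperplane `H = {x_N = 0}`. -/
def hyperplane (k : ℕ) : Set (State k) := {x | lastCoord x = 0}

/-- The closure of `Ω₁ = {x_N > 0}`. -/
def closedOmega₁ (k : ℕ) : Set (State k) := {x | 0 ≤ lastCoord x}

/-- The closure of `Ω₂ = {x_N < 0}`. -/
def closedOmega₂ (k : ℕ) : Set (State k) := {x | lastCoord x ≤ 0}

/-- The velocity set `{b(x, α) : α ∈ A}`. -/
def velocitySet {k d : ℕ} (b : State k → Ctrl d → State k) (A : Set (Ctrl d)) (x : State k) :
    Set (State k) :=
  (fun α => b x α) '' A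

/-- The extended control set `A₁ × A₂ × [0, 1]`. -/
def extControls {d : ℕ} (A₁ A₂ : Set (Ctrl d)) : Set (ExtCtrl d) :=
  A₁ ×ˢ A₂ ×ˢ Icc (0 : ℝ) 1

/-- An increasing sequence, indexed by `m = 1, 2, …`, of compact sets with union `A`. -/
structure CompactExhaustionOf {d : ℕ} (A : Set (Ctrl d)) (Am : ℕ+ → Set (Ctrl d)) : Prop where
  isCompact : ∀ m, IsCompact (Am m)
  mono : Monotone Am
  iUnion_eq : ⋃ m, Am m = A

/-- (HA), for the dynamic `b` and the cost `l` on `D × A`: both are jointly continuous, and `b` is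
Lipschitz in the control, uniformly for `x` in compact sets. -/
structure HypA {k d : ℕ} (D : Set (State k)) (A : Set (Ctrl d))
    (b : State k → Ctrl d → State k) (l : State k → Ctrl d → ℝ) : Prop where
  continuousOn_b : ContinuousOn (fun p : State k × Ctrl d => b p.1 p.2) (D ×ˢ A)
  continuousOn_l : ContinuousOn (fun p : State k × Ctrl d => l p.1 p.2) (D ×ˢ A)
  lipschitz_b : ∀ K ⊆ D, IsCompact K → ∃ L : NNReal, ∀ x ∈ K, LipschitzOnWith L (b x) A

/-- (HB), in the form that concerns the dynamic: every set `{b(x, α) : α ∈ A^m}` is closed and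
convex and contains a ball around `0` (whose radius may depend on `x` and `m`). -/
structure HypB {k d : ℕ} (D : Set (State k)) (Am : ℕ+ → Set (Ctrl d))
    (b : State k → Ctrl d → State k) : Prop where
  isClosed : ∀ x ∈ D, ∀ m, IsClosed (velocitySet b (Am m) x)
  convex : ∀ x ∈ D, ∀ m, Convex ℝ (velocitySet b (Am m) x)
  controllable : ∀ x ∈ D, ∀ m, ∃ δ > 0, Metric.closedBall 0 δ ⊆ velocitySet b (Am m) x

/-- (HC): `|b(x, α)| → ∞` and `l(x, α) / (1 + |b(x, α)|) → ∞` as `|α| → ∞` in `A`, uniformly for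
`x` in compact sets. -/
structure HypC {k d : ℕ} (D : Set (State k)) (A : Set (Ctrl d))
    (b : State k → Ctrl d → State k) (l : State k → Ctrl d → ℝ) : Prop where
  dynamic : ∀ K ⊆ D, IsCompact K → ∀ M : ℝ, ∃ R : ℝ, ∀ x ∈ K, ∀ α ∈ A, R < ‖α‖ → M ≤ ‖b x α‖
  cost : ∀ K ⊆ D, IsCompact K → ∀ M : ℝ, ∃ R : ℝ, ∀ x ∈ K, ∀ α ∈ A, R < ‖α‖ →
    M ≤ l x α / (1 + ‖b x α‖)

/-- The dynamic `b_H(x, a) = μ b₁(x, α₁) + (1 - μ) b₂(x, α₂)` on the hyperplane. -/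
noncomputable def bH {k d : ℕ} (b₁ b₂ : State k → Ctrl d → State k) (x : State k)
    (a : ExtCtrl d) : State k :=
  a.2.2 • b₁ x a.1 + (1 - a.2.2) • b₂ x a.2.1

/-- The global dynamic: `b₁` in `Ω₁`, `b₂` in `Ω₂`, and `b_H` on the hyperplane. -/
noncomputable def dynamic {k d : ℕ} (b₁ b₂ : State k → Ctrl d → State k) (x : State k)
    (a : ExtCtrl d) : State k :=
  if 0 < lastCoord x then b₁ x a.1
  else if lastCoord x < 0 then b₂ x a.2.1
  else bH b₁ b₂ x a

/-- The set `A₀(x)` of the controls that keep the trajectory on the hyperplane at `x`. -/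
def tangentialControls {k d : ℕ} (b₁ b₂ : State k → Ctrl d → State k) (A₁ A₂ : Set (Ctrl d))
    (x : State k) : Set (ExtCtrl d) :=
  {a | a ∈ extControls A₁ A₂ ∧ lastCoord (bH b₁ b₂ x a) = 0}

/-- The set `A₀^reg(x)` of the regular controls at `x`. -/
def regularControls {k d : ℕ} (b₁ b₂ : State k → Ctrl d → State k) (A₁ A₂ : Set (Ctrl d))
    (x : State k) : Set (ExtCtrl d) :=
  {a | a ∈ tangentialControls b₁ b₂ A₁ A₂ x ∧
    lastCoord (b₁ x a.1) ≤ 0 ∧ 0 ≤ lastCoord (b₂ x a.2.1)}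

/-- The set `τ_A(x)` of the controlled trajectories `(X, a)` on `[0, T]` from `x`: `X` is Lipschitz
on `[0, T]`, `a` is in `L^∞((0, T); A₁ × A₂ × [0, 1])`, and `X` solves the controlled equation at
almost every time. Values of `X` and `a` outside `[0, T]` are irrelevant. -/
def trajectories {k d : ℕ} (b₁ b₂ : State k → Ctrl d → State k) (A₁ A₂ : Set (Ctrl d))
    (T : ℝ) (x : State k) : Set ((ℝ → State k) × (ℝ → ExtCtrl d)) :=
  {p | (∃ L : NNReal, LipschitzOnWith L p.1 (Icc 0 T)) ∧
    MemLp p.2 ⊤ (volume.restrict (Ioo 0 T)) ∧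
    (∀ᵐ t ∂(volume.restrict (Ioo 0 T)), p.2 t ∈ extControls A₁ A₂) ∧
    (∀ᵐ t ∂(volume.restrict (Ioo 0 T)), HasDerivAt p.1 (dynamic b₁ b₂ (p.1 t) (p.2 t)) t) ∧
    p.1 0 = x}

/-- The set `τ_A^reg(x)` of the regular trajectories on `[0, T]` from `x`. -/
def regularTrajectories {k d : ℕ} (b₁ b₂ : State k → Ctrl d → State k) (A₁ A₂ : Set (Ctrl d))
    (T : ℝ) (x : State k) : Set ((ℝ → State k) × (ℝ → ExtCtrl d)) :=
  {p | p ∈ trajectories b₁ b₂ A₁ A₂ T x ∧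
    ∀ᵐ t ∂(volume.restrict (Ioo 0 T)), p.1 t ∈ hyperplane k →
      p.2 t ∈ regularControls b₁ b₂ A₁ A₂ (p.1 t)}

/-- The set `τ_A^η(x)` of the `η`-trajectories on `[0, T]` from `x`. -/
def etaTrajectories {k d : ℕ} (b₁ b₂ : State k → Ctrl d → State k) (A₁ A₂ : Set (Ctrl d))
    (η : ℝ) (T : ℝ) (x : State k) : Set ((ℝ → State k) × (ℝ → ExtCtrl d)) :=
  {p | p ∈ trajectories b₁ b₂ A₁ A₂ T x ∧
    ∀ᵐ t ∂(volume.restrict (Ioo 0 T)), p.1 t ∈ hyperplane k →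
      -η ≤ lastCoord (b₂ (p.1 t) (p.2 t).2.1) ∧ lastCoord (b₁ (p.1 t) (p.2 t).1) ≤ η}

end TwoDomain

/-! Fix a time `t` at which `X` lies on the hyperplane and has a derivative `v`; for almost every
such `t`, `v` is tangential. The dynamic of `X^n` is kept as a pair, one contribution per side, and
this pair is averaged over a short interval `[t, r]`. Near `X(t)` the pairs lie close to the set of
all `(θu, (1-θ)w)`, with `u` and `w` velocities of the two sides at `X(t)`. This set is compact and
convex, so the average stays close to it, and the sum of its two components is a difference quotient
of `X^n`, close to `v`.

The normal part of the first average is controlled by the positive part of the last coordinate. In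
`Ω₁` the first contribution is the derivative of that positive part, in `Ω₂` it vanishes, and on the
hyperplane it is at most `η_n`. The integral is therefore at most an increment of the positive part
plus a small error, and tangency makes the increment small compared with `r - t`.

By compactness `v = θu + (1-θ)w` with first contribution pointing out of `Ω₁`, or tangential;
tangency of `v` gives the opposite sign for the second. A velocity of weight zero is replaced by
`0`, which controllability provides, so `v` comes from a regular control
(`exists_regularControl_of_approx`). Measurable selection turns these pointwise choices into a
control (`exists_measurable_regularControl`). -/

/-! ### Calculus of Lipschitz functions and of their positive parts -/

/-- At almost every zero of a real function, the derivative vanishes if it exists. -/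
theorem ae_hasDerivAt_eq_zero_of_eq_zero (f : ℝ → ℝ) :
    ∀ᵐ t, ∀ f', HasDerivAt f f' t → f t = 0 → f' = 0 := by
  -- A zero with nonzero derivative is isolated from the right in the zero set, and a set has only
  -- countably many such points.
  have hc : {t ∈ f ⁻¹' {0} | 𝓝[f ⁻¹' {0} ∩ Ioi t] t = ⊥}.Countable :=
    countable_setOfPred_isolated_right_within
  filter_upwards [hc.ae_notMem volume] with t ht f' hf' h0
  by_contra hne
  have h1 : ∀ᶠ z in 𝓝[>] t, f z ≠ 0 :=
    (hf'.eventually_ne (c := 0) hne).filter_mono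
      (nhdsWithin_mono t fun z hz => ne_of_gt hz)
  refine ht ⟨h0, ?_⟩
  rw [inter_comm, nhdsWithin_inter', ← disjoint_iff, disjoint_principal_right]
  exact h1

/-- The fundamental theorem of calculus for real Lipschitz functions. -/
theorem LipschitzOnWith.intervalIntegral_eq_sub_of_ae_hasDerivAt {f g : ℝ → ℝ} {L : NNReal}
    {a b : ℝ} (hab : a ≤ b) (hf : LipschitzOnWith L f (Icc a b))
    (hg : ∀ᵐ t ∂(volume.restrict (Ioo a b)), HasDerivAt f (g t) t) :
    IntervalIntegrable g volume a b ∧ ∫ t in a..b, g t = f b - f a := by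
  have hac : AbsolutelyContinuousOnInterval f a b :=
    LipschitzOnWith.absolutelyContinuousOnInterval (K := L) (by rwa [uIcc_of_le hab])
  have hae : deriv f =ᵐ[volume.restrict (Ioc a b)] g := by
    rw [← restrict_Ioo_eq_restrict_Ioc]
    exact hg.mono fun t ht => ht.deriv
  rw [← hac.integral_deriv_eq_sub, intervalIntegral.integral_of_le hab,
    intervalIntegral.integral_of_le hab]
  refine ⟨hac.intervalIntegrable_deriv.congr_ae ?_, integral_congr_ae hae.symm⟩
  rwa [uIoc_of_le hab]

/-- The fundamental theorem of calculus for Lipschitz functions with values in a Euclidean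
space. -/
theorem LipschitzOnWith.intervalIntegral_eq_sub_of_ae_hasDerivAt_euclidean {ι : Type*} [Fintype ι]
    {f g : ℝ → EuclideanSpace ℝ ι} {L : NNReal} {a b : ℝ} (hab : a ≤ b)
    (hf : LipschitzOnWith L f (Icc a b))
    (hg : ∀ᵐ t ∂(volume.restrict (Ioo a b)), HasDerivAt f (g t) t)
    (hgi : IntervalIntegrable g volume a b) :
    ∫ t in a..b, g t = f b - f a := by
  ext i
  let P : EuclideanSpace ℝ ι →L[ℝ] ℝ := EuclideanSpace.proj i
  have h1 := P.intervalIntegral_comp_comm hgi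
  have h2 := LipschitzOnWith.intervalIntegral_eq_sub_of_ae_hasDerivAt
    (f := fun t => f t i) (g := fun t => g t i) hab
    (P.lipschitz.comp_lipschitzOnWith hf)
    (hg.mono fun t ht => P.hasFDerivAt.comp_hasDerivAt t ht)
  exact h1.symm.trans h2.2

/-- The increment of the positive part of a Lipschitz function is the integral of the derivative
over the set where the function is positive. -/
theorem LipschitzOnWith.intervalIntegral_posPart_eq_sub {f g : ℝ → ℝ} {L : NNReal}
    {a b : ℝ} (hab : a ≤ b) (hf : LipschitzOnWith L f (Icc a b))
    (hg : ∀ᵐ t ∂(volume.restrict (Ioo a b)), HasDerivAt f (g t) t) :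
    IntervalIntegrable (fun t => if 0 < f t then g t else 0) volume a b ∧
      ∫ t in a..b, (if 0 < f t then g t else 0) = max (f b) 0 - max (f a) 0 := by
  refine LipschitzOnWith.intervalIntegral_eq_sub_of_ae_hasDerivAt
    (f := fun t => max (f t) 0) (L := L) hab ?_ ?_
  · intro x hx y hy
    refine le_trans ?_ (hf hx hy)
    rw [edist_dist, edist_dist]
    refine ENNReal.ofReal_le_ofReal ?_
    rw [Real.dist_eq, Real.dist_eq]
    exact abs_max_sub_max_le_abs _ _ _
  · filter_upwards [hg, ae_restrict_of_ae (ae_hasDerivAt_eq_zero_of_eq_zero f)] with t ht h0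
    rcases lt_trichotomy (f t) 0 with h | h | h
    · rw [if_neg h.not_gt]
      refine (hasDerivAt_const t (0 : ℝ)).congr_of_eventuallyEq ?_
      filter_upwards [ht.continuousAt.eventually_lt continuousAt_const h] with s hs
      exact max_eq_right hs.le
    · rw [if_neg (by simp [h])]
      -- The derivative of `f` is zero here, and the positive part is at most `|f|`, so it inherits
      -- the little-o bound.
      have hgt := h0 _ ht h
      rw [hgt] at ht
      rw [hasDerivAt_iff_isLittleO] at ht ⊢
      refine Asymptotics.IsBigO.trans_isLittleO ?_ ht
      refine Asymptotics.IsBigO.of_bound 1 (Eventually.of_forall fun s => ?_)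
      simp only [h, max_self, smul_zero, sub_zero, one_mul, Real.norm_eq_abs]
      rw [abs_of_nonneg (le_max_right _ _)]
      exact max_le (le_abs_self _) (abs_nonneg _)
    · rw [if_pos h]
      refine ht.congr_of_eventuallyEq ?_
      filter_upwards [continuousAt_const.eventually_lt ht.continuousAt h] with s hs
      exact max_eq_left hs.le

/-! ### Measurable selection -/

/-- Measurable selection for a closed relation with values in a compact metric space. -/
theorem IsClosed.exists_measurable_selection {Y K : Type*} [TopologicalSpace Y]
    [MeasurableSpace Y] [OpensMeasurableSpace Y] [MetricSpace K] [CompactSpace K] [Nonempty K]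
    [MeasurableSpace K] [BorelSpace K] {Γ : Set (Y × K)} (hΓ : IsClosed Γ) :
    ∃ f : Y → K, Measurable f ∧ ∀ y, (∃ k, (y, k) ∈ Γ) → (y, f y) ∈ Γ := by
  classical
  -- Parametrizing `K` by the Cantor set, a compact subset of the line, allows a canonical choice:
  -- the least parameter in each fibre. Its sublevel sets are projections of closed sets along a
  -- compact factor, hence closed on the domain of the relation.
  obtain ⟨g', hg'c, hg's⟩ := exists_nat_bool_continuous_surjective_of_compact K
  let g : cantorSet → K := g' ∘ cantorSetHomeomorphNatToBool
  have hgc : Continuous g := hg'c.comp cantorSetHomeomorphNatToBool.continuous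
  have hgs : Function.Surjective g := hg's.comp cantorSetHomeomorphNatToBool.surjective
  have : CompactSpace cantorSet := isCompact_iff_compactSpace.1 isCompact_cantorSet
  have : Nonempty cantorSet := ⟨cantorSetHomeomorphNatToBool.symm fun _ => true⟩
  let Δ : Set (Y × cantorSet) := (Prod.map id g) ⁻¹' Γ
  have hΔ : IsClosed Δ := hΓ.preimage (continuous_id.prodMap hgc)
  have hmin : ∀ y, ∃ c : cantorSet, (∃ k, (y, k) ∈ Γ) →
      (y, c) ∈ Δ ∧ ∀ c', (y, c') ∈ Δ → c ≤ c' := by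
    intro y
    by_cases hy : ∃ k, (y, k) ∈ Γ
    · have hcl : IsCompact {c | (y, c) ∈ Δ} :=
        (hΔ.preimage (Continuous.prodMk_right y)).isCompact
      obtain ⟨k, hk⟩ := hy
      obtain ⟨c, rfl⟩ := hgs k
      obtain ⟨m, hm, hle⟩ := hcl.exists_isLeast ⟨c, hk⟩
      exact ⟨m, fun _ => ⟨hm, fun c' hc' => hle hc'⟩⟩
    · exact ⟨Classical.arbitrary _, fun h => absurd h hy⟩
  choose s hs using hmin
  have hdom : IsClosed {y | ∃ k, (y, k) ∈ Γ} := by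
    have := isClosedMap_fst_of_compactSpace (X := Y) (Y := K) _ hΓ
    convert this using 1
    ext y; simp
  -- Where the fibre is empty, `s` carries no information; a constant value there keeps the
  -- selection measurable, since the domain is closed.
  let s' : Y → cantorSet := fun y => if ∃ k, (y, k) ∈ Γ then s y else Classical.arbitrary _
  have hs'm : Measurable s' := by
    refine measurable_comap_iff.2 (measurable_of_Iic fun r => ?_)
    have hcl : IsClosed {y | ∃ c : cantorSet, (c : ℝ) ≤ r ∧ (y, c) ∈ Δ} := by
      have := isClosedMap_fst_of_compactSpace (X := Y) (Y := cantorSet) _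
        (hΔ.inter (_root_.isClosed_le (continuous_subtype_val.comp continuous_snd)
          (continuous_const (y := r))))
      convert this using 1
      ext y; simp [and_comm]
    have hset : (Subtype.val ∘ s') ⁻¹' Iic r = {y | ∃ c : cantorSet, (c : ℝ) ≤ r ∧ (y, c) ∈ Δ} ∪
        ({y | ∃ k, (y, k) ∈ Γ}ᶜ ∩ {_y | (Classical.arbitrary cantorSet : ℝ) ≤ r}) := by
      ext y
      by_cases hy : ∃ k, (y, k) ∈ Γ
      · simp only [s', Function.comp, mem_preimage, mem_Iic, mem_union, mem_ofPred_eq, mem_inter_iff,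
          mem_compl_iff, hy, not_true, if_true, false_and, or_false]
        exact ⟨fun h => ⟨s y, h, (hs y hy).1⟩, fun ⟨c, hc, hcΔ⟩ =>
          le_trans (Subtype.coe_le_coe.2 ((hs y hy).2 c hcΔ)) hc⟩
      · simp only [s', Function.comp, mem_preimage, mem_Iic, mem_union, mem_ofPred_eq, mem_inter_iff,
          mem_compl_iff, hy, not_false_eq_true, true_and, if_false]
        exact ⟨Or.inr, fun h => h.elim (fun ⟨c, _, hc⟩ => absurd ⟨g c, hc⟩ hy) id⟩
    rw [hset]
    exact hcl.measurableSet.union (hdom.measurableSet.compl.inter (MeasurableSet.const _))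
  refine ⟨g ∘ s', hgc.measurable.comp hs'm, fun y hy => ?_⟩
  have := (hs y hy).1
  simpa only [Function.comp, s', if_pos hy, Δ, mem_preimage, Prod.map, id] using this

/-! ### Two-sided contributions and their mixtures -/

namespace TwoDomain

/-- The contributions of the two sides to the global dynamic. -/
noncomputable def splitDynamic {k d : ℕ} (b₁ b₂ : State k → Ctrl d → State k) (x : State k)
    (a : ExtCtrl d) : State k × State k :=
  if 0 < lastCoord x then (b₁ x a.1, 0)
  else if lastCoord x < 0 then (0, b₂ x a.2.1)
  else (a.2.2 • b₁ x a.1, (1 - a.2.2) • b₂ x a.2.1)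

/-- The pairs `(θ u, (1 - θ) v)` with `θ ∈ [0, 1]`, `u ∈ B₁` and `v ∈ B₂`. -/
def mixtures {E : Type*} [AddCommGroup E] [Module ℝ E] (B₁ B₂ : Set E) : Set (E × E) :=
  (fun q : ℝ × E × E => (q.1 • q.2.1, (1 - q.1) • q.2.2)) '' (Icc (0 : ℝ) 1 ×ˢ B₁ ×ˢ B₂)

/-- The last coordinate as a continuous linear map. -/
noncomputable def lastCoordL (k : ℕ) : State k →L[ℝ] ℝ := EuclideanSpace.proj (Fin.last k)

theorem continuous_lastCoord {k : ℕ} : Continuous (lastCoord (k := k)) := (lastCoordL k).continuous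

theorem lastCoord_add {k : ℕ} (x y : State k) : lastCoord (x + y) = lastCoord x + lastCoord y := rfl

theorem lastCoord_smul {k : ℕ} (c : ℝ) (x : State k) : lastCoord (c • x) = c * lastCoord x := rfl

theorem lastCoord_zero {k : ℕ} : lastCoord (0 : State k) = 0 := rfl

theorem lastCoord_sub {k : ℕ} (x y : State k) : lastCoord (x - y) = lastCoord x - lastCoord y := rfl

theorem abs_lastCoord_le {k : ℕ} (x : State k) : |lastCoord x| ≤ ‖x‖ := by
  exact PiLp.norm_apply_le x (Fin.last k)

/-- The pair `(θu, (1-θ)v)` is a point of the segment from `(u, 0)` to `(0, v)`. Convexity, not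
evident while `θ`, `u` and `v` all vary, then follows from that of convex joins. -/
theorem mixtures_eq_convexJoin {E : Type*} [AddCommGroup E] [Module ℝ E] (B₁ B₂ : Set E) :
    mixtures B₁ B₂ = convexJoin ℝ (B₁ ×ˢ {0}) ({0} ×ˢ B₂) := by
  ext ⟨p, q⟩
  simp only [mixtures, mem_image, mem_prod, Prod.exists, mem_convexJoin, mem_singleton_iff,
    Prod.mk.injEq]
  constructor
  · rintro ⟨θ, u, v, ⟨hθ, hu, hv⟩, rfl, rfl⟩
    refine ⟨u, 0, ⟨hu, rfl⟩, 0, v, ⟨rfl, hv⟩, θ, 1 - θ, hθ.1, sub_nonneg.2 hθ.2, by ring, ?_⟩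
    simp
  · rintro ⟨u, _, ⟨hu, rfl⟩, _, v, ⟨rfl, hv⟩, a, b, ha, hb, hab, h⟩
    obtain rfl : b = 1 - a := by linarith
    refine ⟨a, u, v, ⟨⟨ha, by linarith⟩, hu, hv⟩, ?_⟩
    simpa using h

theorem convex_mixtures {E : Type*} [AddCommGroup E] [Module ℝ E] {B₁ B₂ : Set E}
    (h₁ : Convex ℝ B₁) (h₂ : Convex ℝ B₂) : Convex ℝ (mixtures B₁ B₂) := by
  rw [mixtures_eq_convexJoin]
  exact (h₁.prod (convex_singleton 0)).convexJoin ((convex_singleton 0).prod h₂)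

theorem isCompact_mixtures {E : Type*} [NormedAddCommGroup E] [NormedSpace ℝ E] {B₁ B₂ : Set E}
    (h₁ : IsCompact B₁) (h₂ : IsCompact B₂) : IsCompact (mixtures B₁ B₂) :=
  (isCompact_Icc.prod (h₁.prod h₂)).image (by fun_prop)

theorem splitDynamic_add {k d : ℕ} (b₁ b₂ : State k → Ctrl d → State k) (x : State k)
    (a : ExtCtrl d) :
    (splitDynamic b₁ b₂ x a).1 + (splitDynamic b₁ b₂ x a).2 = dynamic b₁ b₂ x a := by
  unfold splitDynamic dynamic bH
  split_ifs <;> simp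

/-- The weight is `θ = 1` in `Ω₁`, `θ = 0` in `Ω₂` and `θ = μ` on the hyperplane; moving the
position from `y` to `x` changes each component by at most `ε`. -/
theorem splitDynamic_mem_cthickening {k d : ℕ} {b₁ b₂ : State k → Ctrl d → State k}
    {A₁ A₂ : Set (Ctrl d)} {x y : State k} {a : ExtCtrl d} {ε : ℝ} (hε : 0 ≤ ε)
    (ha : a ∈ extControls A₁ A₂)
    (h₁ : y ∈ closedOmega₁ k → ‖b₁ y a.1 - b₁ x a.1‖ ≤ ε)
    (h₂ : y ∈ closedOmega₂ k → ‖b₂ y a.2.1 - b₂ x a.2.1‖ ≤ ε) :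
    splitDynamic b₁ b₂ y a ∈
      Metric.cthickening ε (mixtures (velocitySet b₁ A₁ x) (velocitySet b₂ A₂ x)) := by
  obtain ⟨ha₁, ha₂, hμ⟩ := ha
  have key : ∀ θ ∈ Icc (0 : ℝ) 1, ∀ p : State k × State k,
      ‖p.1 - θ • b₁ x a.1‖ ≤ ε → ‖p.2 - (1 - θ) • b₂ x a.2.1‖ ≤ ε →
      p ∈ Metric.cthickening ε (mixtures (velocitySet b₁ A₁ x) (velocitySet b₂ A₂ x)) := by
    intro θ hθ p hp₁ hp₂
    refine Metric.mem_cthickening_of_dist_le p (θ • b₁ x a.1, (1 - θ) • b₂ x a.2.1) ε _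
      ⟨(θ, b₁ x a.1, b₂ x a.2.1), ⟨hθ, ⟨_, ha₁, rfl⟩, ⟨_, ha₂, rfl⟩⟩, rfl⟩ ?_
    rw [dist_eq_norm, Prod.norm_def]
    exact max_le hp₁ hp₂
  have hsmul : ∀ c ∈ Icc (0 : ℝ) 1, ∀ u v : State k, ‖u - v‖ ≤ ε → ‖c • u - c • v‖ ≤ ε := by
    intro c hc u v huv
    rw [← smul_sub, norm_smul, Real.norm_of_nonneg hc.1]
    exact (mul_le_of_le_one_left (norm_nonneg _) hc.2).trans huv
  unfold splitDynamic
  split_ifs with hpos hneg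
  · exact key 1 (by simp) _ (by simpa using h₁ hpos.le) (by simpa using hε)
  · exact key 0 (by simp) _ (by simpa using hε) (by simpa using h₂ hneg.le)
  · have h0 : lastCoord y = 0 := le_antisymm (not_lt.1 hpos) (not_lt.1 hneg)
    exact key a.2.2 hμ _ (hsmul _ hμ _ _ (h₁ h0.ge))
      (hsmul _ ⟨by linarith [hμ.2], by linarith [hμ.1]⟩ _ _ (h₂ h0.le))

/-- Along a trajectory, the conditional term on the right is almost everywhere the derivative of the
positive part of the last coordinate. On the hyperplane the weight `μ ≤ 1` gives the bound `μη ≤ η`.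
-/
theorem lastCoord_splitDynamic_fst_le {k d : ℕ} {b₁ b₂ : State k → Ctrl d → State k}
    {A₁ A₂ : Set (Ctrl d)} {y : State k} {a : ExtCtrl d} {η : ℝ} (hη : 0 ≤ η)
    (ha : a ∈ extControls A₁ A₂) (h : y ∈ hyperplane k → lastCoord (b₁ y a.1) ≤ η) :
    lastCoord (splitDynamic b₁ b₂ y a).1 ≤
      (if 0 < lastCoord y then lastCoord (dynamic b₁ b₂ y a) else 0) + η := by
  unfold splitDynamic dynamic
  split_ifs with hpos hneg
  · simpa using hη
  · simpa [lastCoord_zero] using hη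
  · have h0 : lastCoord y = 0 := le_antisymm (not_lt.1 hpos) (not_lt.1 hneg)
    rw [lastCoord_smul, zero_add]
    exact (mul_le_mul_of_nonneg_left (h h0) ha.2.2.1).trans (mul_le_of_le_one_left hη ha.2.2.2)

/-- The fields are controlled only on closed sets of positions and controls, so they are extended by
`0` to obtain a measurable map; this makes the contributions measurable in time. -/
theorem exists_measurable_eqOn_splitDynamic {k d : ℕ} {b₁ b₂ : State k → Ctrl d → State k}
    {A₁ A₂ : Set (Ctrl d)} (hA₁ : IsClosed A₁) (hA₂ : IsClosed A₂)
    (hb₁ : ContinuousOn (fun p : State k × Ctrl d => b₁ p.1 p.2) (closedOmega₁ k ×ˢ A₁))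
    (hb₂ : ContinuousOn (fun p : State k × Ctrl d => b₂ p.1 p.2) (closedOmega₂ k ×ˢ A₂)) :
    ∃ Φ : State k × ExtCtrl d → State k × State k, Measurable Φ ∧
      ∀ y, ∀ a ∈ extControls A₁ A₂, Φ (y, a) = splitDynamic b₁ b₂ y a := by
  classical
  have hD₁ : IsClosed (closedOmega₁ k) := isClosed_le continuous_const continuous_lastCoord
  have hD₂ : IsClosed (closedOmega₂ k) := isClosed_le continuous_lastCoord continuous_const
  have hm₁ := hb₁.measurable_piecewise (g := fun _ => 0) continuousOn_const
    (hD₁.prod hA₁).measurableSet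
  have hm₂ := hb₂.measurable_piecewise (g := fun _ => 0) continuousOn_const
    (hD₂.prod hA₂).measurableSet
  set β₁ := (closedOmega₁ k ×ˢ A₁).piecewise (fun p : State k × Ctrl d => b₁ p.1 p.2) fun _ => 0
  set β₂ := (closedOmega₂ k ×ˢ A₂).piecewise (fun p : State k × Ctrl d => b₂ p.1 p.2) fun _ => 0
  have e₁ : ∀ y, 0 ≤ lastCoord y → ∀ α ∈ A₁, β₁ (y, α) = b₁ y α := fun y hy α hα =>
    piecewise_eq_of_mem (closedOmega₁ k ×ˢ A₁) _ _ ⟨hy, hα⟩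
  have e₂ : ∀ y, lastCoord y ≤ 0 → ∀ α ∈ A₂, β₂ (y, α) = b₂ y α := fun y hy α hα =>
    piecewise_eq_of_mem (closedOmega₂ k ×ˢ A₂) _ _ ⟨hy, hα⟩
  have hlc : Measurable fun p : State k × ExtCtrl d => lastCoord p.1 :=
    continuous_lastCoord.measurable.comp measurable_fst
  refine ⟨fun p => if 0 < lastCoord p.1 then (β₁ (p.1, p.2.1), 0)
    else if lastCoord p.1 < 0 then (0, β₂ (p.1, p.2.2.1))
    else (p.2.2.2 • β₁ (p.1, p.2.1), (1 - p.2.2.2) • β₂ (p.1, p.2.2.1)), ?_, ?_⟩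
  · refine Measurable.ite (measurableSet_lt measurable_const hlc) (by fun_prop)
      (Measurable.ite (measurableSet_lt hlc measurable_const) (by fun_prop) (by fun_prop))
  · intro y a ha
    unfold splitDynamic
    split_ifs with hpos hneg
    · simp only [if_pos hpos, e₁ y hpos.le _ ha.1]
    · simp only [if_neg hpos, if_pos hneg, e₂ y hneg.le _ ha.2.1]
    · simp only [if_neg hpos, if_neg hneg, e₁ y (not_lt.1 hneg) _ ha.1, e₂ y (not_lt.1 hpos) _ ha.2.1]

/-! ### Averages along trajectories and passage to the limit -/

/-- The increment of an `η`-trajectory over a time interval is, up to a small error, a mixture of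
the velocities at a nearby point `x`. -/
theorem exists_mixture_of_etaTrajectory {k d : ℕ} {b₁ b₂ : State k → Ctrl d → State k}
    {A₁ A₂ : Set (Ctrl d)} (hA₁ : IsClosed A₁) (hA₂ : IsClosed A₂)
    (hb₁ : ContinuousOn (fun p : State k × Ctrl d => b₁ p.1 p.2) (closedOmega₁ k ×ˢ A₁))
    (hb₂ : ContinuousOn (fun p : State k × Ctrl d => b₂ p.1 p.2) (closedOmega₂ k ×ˢ A₂))
    {x : State k} (hB₁ : IsCompact (velocitySet b₁ A₁ x)) (hB₂ : IsCompact (velocitySet b₂ A₂ x))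
    (hc₁ : Convex ℝ (velocitySet b₁ A₁ x)) (hc₂ : Convex ℝ (velocitySet b₂ A₂ x))
    {η T : ℝ} (hη : 0 ≤ η) {x₀ : State k} {Y : ℝ → State k} {α : ℝ → ExtCtrl d}
    (hY : (Y, α) ∈ etaTrajectories b₁ b₂ A₁ A₂ η T x₀) {s r ε : ℝ} (hε : 0 ≤ ε)
    (hs : 0 < s) (hsr : s < r) (hr : r < T)
    (h₁ : ∀ t ∈ Icc s r, Y t ∈ closedOmega₁ k → ∀ a ∈ A₁, ‖b₁ (Y t) a - b₁ x a‖ ≤ ε)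
    (h₂ : ∀ t ∈ Icc s r, Y t ∈ closedOmega₂ k → ∀ a ∈ A₂, ‖b₂ (Y t) a - b₂ x a‖ ≤ ε) :
    ∃ p ∈ mixtures (velocitySet b₁ A₁ x) (velocitySet b₂ A₂ x),
      ‖p.1 + p.2 - (r - s)⁻¹ • (Y r - Y s)‖ ≤ 2 * ε ∧
      lastCoord p.1 ≤
        (r - s)⁻¹ * (max (lastCoord (Y r)) 0 - max (lastCoord (Y s)) 0) + η + ε := by
  obtain ⟨⟨⟨L, hL⟩, hαmem, hα, hder, -⟩, hreg⟩ := hY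
  simp only at hL hαmem hα hder hreg
  have hsub : Ioc s r ⊆ Ioo 0 T := fun t ht => ⟨hs.trans ht.1, ht.2.trans_lt hr⟩
  have hL' : LipschitzOnWith L Y (Icc s r) :=
    hL.mono fun t ht => ⟨hs.le.trans ht.1, ht.2.trans hr.le⟩
  set μ := volume.restrict (Ioc s r)
  have hle : μ ≤ volume.restrict (Ioo 0 T) := Measure.restrict_mono hsub le_rfl
  replace hα : ∀ᵐ t ∂μ, α t ∈ extControls A₁ A₂ := ae_mono hle hα
  replace hder : ∀ᵐ t ∂μ, HasDerivAt Y (dynamic b₁ b₂ (Y t) (α t)) t := ae_mono hle hder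
  replace hreg := ae_mono hle hreg
  have hderO : ∀ᵐ t ∂(volume.restrict (Ioo s r)),
      HasDerivAt Y (dynamic b₁ b₂ (Y t) (α t)) t := by
    rw [restrict_Ioo_eq_restrict_Ioc]; exact hder
  have hmem : ∀ᵐ t ∂μ, t ∈ Ioc s r := ae_restrict_mem measurableSet_Ioc
  let F : ℝ → State k × State k := fun t => splitDynamic b₁ b₂ (Y t) (α t)
  let S := Metric.cthickening ε (mixtures (velocitySet b₁ A₁ x) (velocitySet b₂ A₂ x))
  have hScomp : IsCompact (mixtures (velocitySet b₁ A₁ x) (velocitySet b₂ A₂ x)) :=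
    isCompact_mixtures hB₁ hB₂
  have hFS : ∀ᵐ t ∂μ, F t ∈ S := by
    filter_upwards [hα, hmem] with t ht htI
    exact splitDynamic_mem_cthickening hε ht (fun h => h₁ t (Ioc_subset_Icc_self htI) h _ ht.1)
      (fun h => h₂ t (Ioc_subset_Icc_self htI) h _ ht.2.1)
  have hFm : AEStronglyMeasurable F μ := by
    obtain ⟨Φ, hΦ, hΦeq⟩ := exists_measurable_eqOn_splitDynamic hA₁ hA₂ hb₁ hb₂
    have hYm : AEMeasurable Y μ :=
      (hL'.continuousOn.mono Ioc_subset_Icc_self).aemeasurable measurableSet_Ioc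
    have hαm : AEMeasurable α μ := hαmem.1.aemeasurable.mono_measure hle
    refine ((hΦ.comp_aemeasurable (hYm.prodMk hαm)).congr ?_).aestronglyMeasurable
    exact hα.mono fun t ht => hΦeq _ _ ht
  obtain ⟨R, hR⟩ := (hScomp.isBounded.cthickening (δ := ε)).exists_norm_le
  have hFi : IntegrableOn F (Ioc s r) :=
    Integrable.of_bound hFm R (hFS.mono fun t ht => hR _ ht)
  have hFii : IntervalIntegrable F volume s r :=
    (intervalIntegrable_iff_integrableOn_Ioc_of_le hsr.le).2 hFi
  have hvol : volume (Ioc s r) ≠ 0 := by simp [hsr]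
  -- An average of values in a closed convex set stays in it; this is where convexity of the
  -- velocity sets enters.
  have havg := ((convex_mixtures hc₁ hc₂).cthickening ε).set_average_mem
    Metric.isClosed_cthickening hvol (by simp) hFS hFi
  rw [← uIoc_of_le hsr.le, interval_average_eq] at havg
  set q := (r - s)⁻¹ • ∫ t in s..r, F t with hq
  rw [hScomp.cthickening_eq_biUnion_closedBall hε] at havg
  simp only [mem_iUnion, Metric.mem_closedBall] at havg
  obtain ⟨p, hp, hqp⟩ := havg
  rw [dist_comm, dist_eq_norm, Prod.norm_def] at hqp
  have hqp₁ : ‖p.1 - q.1‖ ≤ ε := (le_max_left _ _).trans hqp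
  have hqp₂ : ‖p.2 - q.2‖ ≤ ε := (le_max_right _ _).trans hqp
  have hrs : 0 < r - s := sub_pos.2 hsr
  refine ⟨p, hp, ?_, ?_⟩
  · let P : State k × State k →L[ℝ] State k :=
      ContinuousLinearMap.fst ℝ _ _ + ContinuousLinearMap.snd ℝ _ _
    have hP : ∀ t, P (F t) = dynamic b₁ b₂ (Y t) (α t) := fun t => splitDynamic_add _ _ _ _
    have hPi : IntervalIntegrable (fun t => P (F t)) volume s r :=
      (intervalIntegrable_iff_integrableOn_Ioc_of_le hsr.le).2 (P.integrable_comp hFi)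
    have h1 := P.intervalIntegral_comp_comm hFii
    have h2 := LipschitzOnWith.intervalIntegral_eq_sub_of_ae_hasDerivAt_euclidean hsr.le hL'
      (g := fun t => P (F t)) (by simpa only [hP] using hderO) hPi
    have hPq : q.1 + q.2 = (r - s)⁻¹ • (Y r - Y s) := by
      have : q.1 + q.2 = P q := rfl
      rw [this, hq, map_smul, ← h1, h2]
    rw [← hPq, add_sub_add_comm]
    exact (norm_add_le _ _).trans (by linarith)
  · let P : State k × State k →L[ℝ] ℝ := (lastCoordL k).comp (ContinuousLinearMap.fst ℝ _ _)
    have h1 := P.intervalIntegral_comp_comm hFii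
    have hPi : IntervalIntegrable (fun t => P (F t)) volume s r :=
      (intervalIntegrable_iff_integrableOn_Ioc_of_le hsr.le).2 (P.integrable_comp hFi)
    obtain ⟨hGi, hG⟩ := LipschitzOnWith.intervalIntegral_posPart_eq_sub (f := fun t => lastCoord (Y t))
      (g := fun t => lastCoord (dynamic b₁ b₂ (Y t) (α t))) hsr.le
      ((lastCoordL k).lipschitz.comp_lipschitzOnWith hL')
      (hderO.mono fun t ht => (lastCoordL k).hasFDerivAt.comp_hasDerivAt t ht)
    -- The first term on the right integrates exactly to the increment of the positive part of the
    -- last coordinate.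
    have hmono : ∫ t in s..r, P (F t) ≤ ∫ t in s..r,
        ((if 0 < lastCoord (Y t) then lastCoord (dynamic b₁ b₂ (Y t) (α t)) else 0) + η) := by
      rw [intervalIntegral.integral_of_le hsr.le, intervalIntegral.integral_of_le hsr.le]
      refine integral_mono_ae hPi.1 (hGi.add intervalIntegrable_const).1 ?_
      filter_upwards [hα, hreg] with t ht htreg
      exact lastCoord_splitDynamic_fst_le hη ht fun h => (htreg h).2
    rw [intervalIntegral.integral_add hGi intervalIntegrable_const, hG,
      intervalIntegral.integral_const, smul_eq_mul, h1] at hmono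
    have hPq : lastCoord q.1 = (r - s)⁻¹ * P (∫ t in s..r, F t) := by
      have : lastCoord q.1 = P q := rfl
      rw [this, hq, map_smul, smul_eq_mul]
    have h3 := (abs_le.1 ((abs_lastCoord_le _).trans hqp₁)).2
    rw [lastCoord_sub] at h3
    have h4 := mul_le_mul_of_nonneg_left hmono (inv_nonneg.2 hrs.le)
    rw [← hPq, mul_add, inv_mul_cancel_left₀ hrs.ne'] at h4
    linarith

/-- The velocity of a limit of `η`-trajectories, at a time when it lies on the hyperplane and moves
tangentially, is a mixture of velocities with almost regular contributions. -/
theorem exists_mixture_of_tendstoUniformlyOn {k d : ℕ} {b₁ b₂ : State k → Ctrl d → State k}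
    {A₁ A₂ : Set (Ctrl d)} (hA₁ : IsCompact A₁) (hA₂ : IsCompact A₂)
    (hb₁ : ContinuousOn (fun p : State k × Ctrl d => b₁ p.1 p.2) (closedOmega₁ k ×ˢ A₁))
    (hb₂ : ContinuousOn (fun p : State k × Ctrl d => b₂ p.1 p.2) (closedOmega₂ k ×ˢ A₂))
    (hc₁ : ∀ x ∈ closedOmega₁ k, Convex ℝ (velocitySet b₁ A₁ x))
    (hc₂ : ∀ x ∈ closedOmega₂ k, Convex ℝ (velocitySet b₂ A₂ x))
    (hB₁ : ∀ x ∈ closedOmega₁ k, IsCompact (velocitySet b₁ A₁ x))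
    (hB₂ : ∀ x ∈ closedOmega₂ k, IsCompact (velocitySet b₂ A₂ x))
    {η : ℕ → ℝ} (hη_pos : ∀ n, 0 < η n) (hη : Tendsto η atTop (𝓝 0)) {T : ℝ}
    {x : ℕ → State k} {X : ℕ → ℝ → State k} {α : ℕ → ℝ → ExtCtrl d}
    (hX : ∀ n, (X n, α n) ∈ etaTrajectories b₁ b₂ A₁ A₂ (η n) T (x n))
    {Xlim : ℝ → State k} (hconv : TendstoUniformlyOn X Xlim atTop (Icc 0 T))
    {t : ℝ} (ht : t ∈ Ioo 0 T) (hH : Xlim t ∈ hyperplane k) {v : State k}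
    (hder : HasDerivAt Xlim v t) (hv : lastCoord v = 0) {ε : ℝ} (hε : 0 < ε) :
    ∃ p ∈ mixtures (velocitySet b₁ A₁ (Xlim t)) (velocitySet b₂ A₂ (Xlim t)),
      ‖p.1 + p.2 - v‖ ≤ 5 * ε ∧ lastCoord p.1 ≤ 5 * ε := by
  have hH0 : lastCoord (Xlim t) = 0 := hH
  have near : ∀ {D : Set (State k)} {A : Set (Ctrl d)} {b : State k → Ctrl d → State k},
      IsCompact A → ContinuousOn (fun p : State k × Ctrl d => b p.1 p.2) (D ×ˢ A) →
      Xlim t ∈ D → ∃ δ > 0, ∀ y ∈ D, dist y (Xlim t) < δ → ∀ a ∈ A,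
        ‖b y a - b (Xlim t) a‖ ≤ ε := by
    intro D A b hA hb hD
    -- Compactness of the control set makes the neighbourhood independent of the control.
    obtain ⟨V, hV, hV'⟩ := hA.mem_uniformity_of_prod (f := b) hb hD (Metric.dist_mem_uniformity hε)
    obtain ⟨δ, hδ, hδV⟩ := Metric.mem_nhdsWithin_iff.1 hV
    refine ⟨δ, hδ, fun y hy hyd a ha => ?_⟩
    have := hV' y (hδV ⟨hyd, hy⟩) a ha
    rw [← dist_eq_norm]
    exact le_of_lt this
  have hD₁ : Xlim t ∈ closedOmega₁ k := hH0.ge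
  have hD₂ : Xlim t ∈ closedOmega₂ k := hH0.le
  obtain ⟨δ₁, hδ₁, hn₁⟩ := near hA₁ hb₁ hD₁
  obtain ⟨δ₂, hδ₂, hn₂⟩ := near hA₂ hb₂ hD₂
  set δ := min δ₁ δ₂
  have hδ : 0 < δ := lt_min hδ₁ hδ₂
  have hcont : ∀ᶠ s in 𝓝 t, dist (Xlim s) (Xlim t) < δ / 2 :=
    Metric.tendsto_nhds.1 hder.continuousAt _ (half_pos hδ)
  have hlin : ∀ᶠ s in 𝓝 t, ‖Xlim s - Xlim t - (s - t) • v‖ ≤ ε * ‖s - t‖ :=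
    (hasDerivAt_iff_isLittleO.1 hder).bound hε
  obtain ⟨ρ, hρ, hball⟩ := Metric.eventually_nhds_iff.1
    ((hcont.and hlin).and (eventually_lt_nhds ht.2))
  set r := t + ρ / 2 with hr_def
  have htr : t < r := by linarith
  have hr_ball : ∀ s ∈ Icc t r, dist s t < ρ := by
    intro s hs
    rw [Real.dist_eq, abs_of_nonneg (sub_nonneg.2 hs.1)]
    linarith [hs.2]
  obtain ⟨⟨-, hlin_r⟩, hrT⟩ := hball (hr_ball r ⟨htr.le, le_rfl⟩)
  have hh : 0 < r - t := sub_pos.2 htr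
  rw [Real.norm_of_nonneg hh.le] at hlin_r
  -- The index is chosen after `r`: an error `ε * (r - t)` in position costs only `ε` in a
  -- difference quotient.
  obtain ⟨n, hXn, hηn⟩ := ((Metric.tendstoUniformlyOn_iff.1 hconv (min (δ / 2) (ε * (r - t)))
    (lt_min (half_pos hδ) (mul_pos hε hh))).and (hη.eventually_lt_const hε)).exists
  have hIcc : ∀ s ∈ Icc t r, s ∈ Icc 0 T := fun s hs =>
    ⟨ht.1.le.trans hs.1, hs.2.trans hrT.le⟩
  have hXδ : ∀ s ∈ Icc t r, dist (X n s) (Xlim t) < δ := by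
    intro s hs
    have e1 := (hXn s (hIcc s hs)).trans_le (min_le_left _ _)
    have e2 := (hball (hr_ball s hs)).1.1
    rw [dist_comm] at e1
    linarith [dist_triangle (X n s) (Xlim s) (Xlim t)]
  have hXε : ∀ s ∈ Icc t r, ‖X n s - Xlim s‖ ≤ ε * (r - t) := by
    intro s hs
    have e1 := (hXn s (hIcc s hs)).trans_le (min_le_right _ _)
    rw [dist_comm, dist_eq_norm] at e1
    exact e1.le
  obtain ⟨p, hp, hp₁, hp₂⟩ := exists_mixture_of_etaTrajectory hA₁.isClosed hA₂.isClosed hb₁ hb₂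
    (hB₁ _ hD₁) (hB₂ _ hD₂) (hc₁ _ hD₁) (hc₂ _ hD₂) (hη_pos n).le (hX n) hε.le ht.1 htr hrT
    (fun s hs hy a ha => hn₁ _ hy ((hXδ s hs).trans_le (min_le_left _ _)) a ha)
    (fun s hs hy a ha => hn₂ _ hy ((hXδ s hs).trans_le (min_le_right _ _)) a ha)
  have hXr := hXε r ⟨htr.le, le_rfl⟩
  have hXt := hXε t ⟨le_rfl, htr.le⟩
  refine ⟨p, hp, ?_, ?_⟩
  -- Each endpoint contributes `ε` and the linearization of the limit another `ε`; with the `2 * ε`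
  -- of `hp₁` this makes `5 * ε`.
  · have hdiff : ‖(r - t)⁻¹ • (X n r - X n t) - v‖ ≤ 3 * ε := by
      have e : (r - t)⁻¹ • (X n r - X n t) - v = (r - t)⁻¹ • ((X n r - Xlim r) - (X n t - Xlim t)
          + (Xlim r - Xlim t - (r - t) • v)) := by
        have : v = (r - t)⁻¹ • (r - t) • v := by rw [smul_smul, inv_mul_cancel₀ hh.ne', one_smul]
        nth_rewrite 1 [this]
        rw [← smul_sub]
        congr 1
        abel
      rw [e, norm_smul, Real.norm_of_nonneg (inv_nonneg.2 hh.le), inv_mul_le_iff₀ hh]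
      refine (norm_add_le _ _).trans ?_
      linarith [norm_sub_le (X n r - Xlim r) (X n t - Xlim t)]
    have := norm_add_le (p.1 + p.2 - (r - t)⁻¹ • (X n r - X n t))
      ((r - t)⁻¹ • (X n r - X n t) - v)
    rw [sub_add_sub_cancel] at this
    linarith
  · have e1 := (abs_le.1 ((abs_lastCoord_le _).trans hlin_r)).2
    have e2 := (abs_le.1 ((abs_lastCoord_le _).trans hXr)).2
    rw [lastCoord_sub, lastCoord_sub, lastCoord_smul, hv, hH0] at e1
    rw [lastCoord_sub] at e2
    -- The limit starts at height `0` with tangential velocity, so the height at `r` is at most `2 *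
    -- ε * (r - t)`; the positive part at `t` is subtracted and can be dropped.
    have e3 : max (lastCoord (X n r)) 0 - max (lastCoord (X n t)) 0 ≤ (r - t) * (2 * ε) := by
      have : max (lastCoord (X n r)) 0 ≤ (r - t) * (2 * ε) :=
        max_le (by linarith) (by positivity)
      linarith [le_max_right (lastCoord (X n t)) 0]
    have e4 := (inv_mul_le_iff₀ hh).2 e3
    linarith

/-! ### Regular controls realizing the limit velocity -/

/-- A tangential velocity that can be approximated by mixtures with almost regular contributions is
the velocity of a regular control. -/
theorem exists_regularControl_of_approx {k d : ℕ} {b₁ b₂ : State k → Ctrl d → State k}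
    {A₁ A₂ : Set (Ctrl d)} {x v : State k} (hB₁ : IsCompact (velocitySet b₁ A₁ x))
    (hB₂ : IsCompact (velocitySet b₂ A₂ x)) (h0₁ : (0 : State k) ∈ velocitySet b₁ A₁ x)
    (h0₂ : (0 : State k) ∈ velocitySet b₂ A₂ x) (hv : lastCoord v = 0)
    (happ : ∀ ε > 0, ∃ p ∈ mixtures (velocitySet b₁ A₁ x) (velocitySet b₂ A₂ x),
      ‖p.1 + p.2 - v‖ ≤ 5 * ε ∧ lastCoord p.1 ≤ 5 * ε) :
    ∃ a ∈ regularControls b₁ b₂ A₁ A₂ x, bH b₁ b₂ x a = v := by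
  -- `φ` measures the failure of both requirements. Its minimum over the compact set of mixtures is
  -- attained, and the approximations force it to be at most `0`.
  let φ : State k × State k → ℝ := fun p => max ‖p.1 + p.2 - v‖ (lastCoord p.1)
  have hφ : Continuous φ :=
    (((continuous_fst.add continuous_snd).sub continuous_const).norm).max
      (continuous_lastCoord.comp continuous_fst)
  obtain ⟨p₀, hp₀, -⟩ := happ 1 one_pos
  obtain ⟨p, hp, hmin⟩ := (isCompact_mixtures hB₁ hB₂).exists_isMinOn ⟨p₀, hp₀⟩ hφ.continuousOn
  have hle : φ p ≤ 0 := by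
    refine le_of_forall_pos_le_add fun ε hε => ?_
    obtain ⟨q, hq, hq₁, hq₂⟩ := happ (ε / 5) (by positivity)
    have h1 : φ p ≤ φ q := hmin hq
    have h2 : φ q ≤ ε := max_le (by linarith) (by linarith)
    linarith
  have hsum : p.1 + p.2 = v := by
    rw [← sub_eq_zero, ← norm_le_zero_iff]
    exact (le_max_left _ _).trans hle
  have hlast : lastCoord p.1 ≤ 0 := (le_max_right _ _).trans hle
  have hlast₂ : 0 ≤ lastCoord p.2 := by
    have := lastCoord_add p.1 p.2
    rw [hsum, hv] at this
    linarith
  obtain ⟨⟨θ, u, w⟩, ⟨hθ, hu, hw⟩, rfl⟩ := hp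
  simp only at hsum hlast hlast₂ hθ hu hw
  rw [lastCoord_smul] at hlast hlast₂
  -- A positive weight can be divided out of the sign condition. If `θ = 0`, then `u` may point the
  -- wrong way but does not contribute, and `0` takes its place.
  obtain ⟨u', ⟨α₁, hα₁, rfl⟩, hu'last, hu'⟩ :
      ∃ u' ∈ velocitySet b₁ A₁ x, lastCoord u' ≤ 0 ∧ θ • u' = θ • u := by
    rcases hθ.1.eq_or_lt with h | h
    · exact ⟨0, h0₁, le_rfl, by simp [← h]⟩
    · exact ⟨u, hu, nonpos_of_mul_nonpos_right hlast h, rfl⟩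
  obtain ⟨w', ⟨α₂, hα₂, rfl⟩, hw'last, hw'⟩ :
      ∃ w' ∈ velocitySet b₂ A₂ x, 0 ≤ lastCoord w' ∧ (1 - θ) • w' = (1 - θ) • w := by
    rcases (sub_nonneg.2 hθ.2).eq_or_lt with h | h
    · exact ⟨0, h0₂, le_rfl, by simp [← h]⟩
    · exact ⟨w, hw, nonneg_of_mul_nonneg_right hlast₂ h, rfl⟩
  have hbH : bH b₁ b₂ x (α₁, α₂, θ) = v := by
    simp only at hu' hw'
    simp only [bH, hu', hw', hsum]
  exact ⟨(α₁, α₂, θ), ⟨⟨⟨hα₁, hα₂, hθ⟩, by rw [hbH, hv]⟩, hu'last, hw'last⟩, hbH⟩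

/-- A control that is measurable in the position and the velocity and that realizes every velocity
of a regular control on the hyperplane. -/
theorem exists_measurable_regularControl {k d : ℕ} {b₁ b₂ : State k → Ctrl d → State k}
    {A₁ A₂ : Set (Ctrl d)} (hA₁ : IsCompact A₁) (hA₂ : IsCompact A₂)
    (hne₁ : A₁.Nonempty) (hne₂ : A₂.Nonempty)
    (hb₁ : ContinuousOn (fun p : State k × Ctrl d => b₁ p.1 p.2) (closedOmega₁ k ×ˢ A₁))
    (hb₂ : ContinuousOn (fun p : State k × Ctrl d => b₂ p.1 p.2) (closedOmega₂ k ×ˢ A₂)) :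
    ∃ f : State k × State k → ExtCtrl d, Measurable f ∧ (∀ y, f y ∈ extControls A₁ A₂) ∧
      ∀ y ∈ hyperplane k, ∀ a ∈ regularControls b₁ b₂ A₁ A₂ y,
        f (y, bH b₁ b₂ y a) ∈ regularControls b₁ b₂ A₁ A₂ y ∧
        bH b₁ b₂ y (f (y, bH b₁ b₂ y a)) = bH b₁ b₂ y a := by
  have hK : IsCompact (extControls A₁ A₂) := hA₁.prod (hA₂.prod isCompact_Icc)
  have : CompactSpace (extControls A₁ A₂) := isCompact_iff_compactSpace.1 hK
  have : Nonempty (extControls A₁ A₂) :=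
    (hne₁.prod (hne₂.prod ⟨0, by simp⟩)).to_subtype
  let K := extControls A₁ A₂
  let D : Set ((State k × State k) × K) := {z | z.1.1 ∈ hyperplane k}
  have hH : IsClosed (hyperplane k) := isClosed_eq continuous_lastCoord continuous_const
  have hD : IsClosed D := hH.preimage (continuous_fst.comp continuous_fst)
  have c₁ : ContinuousOn (fun z : (State k × State k) × K => b₁ z.1.1 z.2.1.1) D :=
    hb₁.comp (f := fun z : (State k × State k) × K => (z.1.1, z.2.1.1)) (by fun_prop)
      fun z hz => ⟨(show lastCoord z.1.1 = 0 from hz).ge, z.2.2.1⟩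
  have c₂ : ContinuousOn (fun z : (State k × State k) × K => b₂ z.1.1 z.2.1.2.1) D :=
    hb₂.comp (f := fun z : (State k × State k) × K => (z.1.1, z.2.1.2.1)) (by fun_prop)
      fun z hz => ⟨(show lastCoord z.1.1 = 0 from hz).le, z.2.2.2.1⟩
  have c₃ : ContinuousOn (fun z : (State k × State k) × K => bH b₁ b₂ z.1.1 z.2.1) D := by
    unfold bH
    have hμ : ContinuousOn (fun z : (State k × State k) × K => z.2.1.2.2) D := by fun_prop
    exact (hμ.smul c₁).add ((continuousOn_const.sub hμ).smul c₂)
  -- The realized velocity is part of the relation. In position, velocity and control jointly the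
  -- relation is closed, although in time it need not be, since the velocity is only measurable in
  -- time.
  let g : (State k × State k) × K → State k × ℝ × ℝ × ℝ := fun z =>
    (bH b₁ b₂ z.1.1 z.2.1 - z.1.2, lastCoord (bH b₁ b₂ z.1.1 z.2.1),
      lastCoord (b₁ z.1.1 z.2.1.1), lastCoord (b₂ z.1.1 z.2.1.2.1))
  have hg : ContinuousOn g D :=
    (c₃.sub (by fun_prop)).prodMk ((continuous_lastCoord.comp_continuousOn c₃).prodMk
      ((continuous_lastCoord.comp_continuousOn c₁).prodMk
        (continuous_lastCoord.comp_continuousOn c₂)))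
  have hΓ : IsClosed (D ∩ g ⁻¹' ({0} ×ˢ {0} ×ˢ Iic 0 ×ˢ Ici 0)) :=
    hg.preimage_isClosed_of_isClosed hD
      (isClosed_singleton.prod (isClosed_singleton.prod (isClosed_Iic.prod isClosed_Ici)))
  obtain ⟨f, hfm, hf⟩ := hΓ.exists_measurable_selection
  refine ⟨fun y => f y, measurable_subtype_coe.comp hfm, fun y => (f y).2, ?_⟩
  rintro y hy a ⟨⟨haK, ha0⟩, ha₁, ha₂⟩
  obtain ⟨-, h1, h2, h3, h4⟩ :=
    hf (y, bH b₁ b₂ y a) ⟨⟨a, haK⟩, hy, sub_self _, ha0, ha₁, ha₂⟩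
  exact ⟨⟨⟨(f _).2, h2⟩, h3, h4⟩, sub_eq_zero.1 h1⟩

end TwoDomain

/-! ### Assembly of the regular control -/

theorem mainTheorem12 {k d : ℕ}
    (A₁ A₂ : Set (TwoDomain.Ctrl d))
    (hA₁_closed : IsClosed A₁) (hA₂_closed : IsClosed A₂)
    (hA₁_convex : Convex ℝ A₁) (hA₂_convex : Convex ℝ A₂)
    (Am₁ Am₂ : ℕ+ → Set (TwoDomain.Ctrl d))
    (hAm₁ : TwoDomain.CompactExhaustionOf A₁ Am₁)
    (hAm₂ : TwoDomain.CompactExhaustionOf A₂ Am₂)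
    (b₁ b₂ : TwoDomain.State k → TwoDomain.Ctrl d → TwoDomain.State k)
    (l₁ l₂ : TwoDomain.State k → TwoDomain.Ctrl d → ℝ)
    (hHA₁ : TwoDomain.HypA (TwoDomain.closedOmega₁ k) A₁ b₁ l₁)
    (hHA₂ : TwoDomain.HypA (TwoDomain.closedOmega₂ k) A₂ b₂ l₂)
    (hHB₁ : TwoDomain.HypB (TwoDomain.closedOmega₁ k) Am₁ b₁)
    (hHB₂ : TwoDomain.HypB (TwoDomain.closedOmega₂ k) Am₂ b₂)
    (hHC₁ : TwoDomain.HypC (TwoDomain.closedOmega₁ k) A₁ b₁ l₁)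
    (hHC₂ : TwoDomain.HypC (TwoDomain.closedOmega₂ k) A₂ b₂ l₂)
    (m : ℕ+) (T : ℝ) (hT : 0 < T)
    (η : ℕ → ℝ) (hη_pos : ∀ n, 0 < η n) (hη : Tendsto η atTop (𝓝 0))
    (x : ℕ → TwoDomain.State k)
    (X : ℕ → ℝ → TwoDomain.State k) (α : ℕ → ℝ → TwoDomain.ExtCtrl d)
    (hX : ∀ n, (X n, α n) ∈
      TwoDomain.etaTrajectories b₁ b₂ (Am₁ m) (Am₂ m) (η n) T (x n))
    (xlim : TwoDomain.State k) (Xlim : ℝ → TwoDomain.State k)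
    (hXlim : ∃ αlim : ℝ → TwoDomain.ExtCtrl d,
      (Xlim, αlim) ∈ TwoDomain.trajectories b₁ b₂ (Am₁ m) (Am₂ m) T xlim)
    (hconv : TendstoUniformlyOn X Xlim atTop (Icc 0 T)) :
    ∃ a : ℝ → TwoDomain.ExtCtrl d,
      (Xlim, a) ∈ TwoDomain.regularTrajectories b₁ b₂ (Am₁ m) (Am₂ m) T xlim := by

  classical
  obtain ⟨αlim, ⟨L, hL⟩, hαmem, hαK, hαder, hX0⟩ := hXlim
  simp only at hL hαmem hαK hαder hX0
  have hsub₁ : Am₁ m ⊆ A₁ := hAm₁.iUnion_eq ▸ subset_iUnion Am₁ m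
  have hsub₂ : Am₂ m ⊆ A₂ := hAm₂.iUnion_eq ▸ subset_iUnion Am₂ m
  have hK₁ := hAm₁.isCompact m
  have hK₂ := hAm₂.isCompact m
  have hb₁ := hHA₁.continuousOn_b.mono (prod_mono_right hsub₁)
  have hb₂ := hHA₂.continuousOn_b.mono (prod_mono_right hsub₂)
  have hB₁ : ∀ y ∈ TwoDomain.closedOmega₁ k,
      IsCompact (TwoDomain.velocitySet b₁ (Am₁ m) y) := fun y hy =>
    hK₁.image_of_continuousOn
      (hb₁.comp (f := fun α => (y, α)) (by fun_prop) fun _ hα => ⟨hy, hα⟩)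
  have hB₂ : ∀ y ∈ TwoDomain.closedOmega₂ k,
      IsCompact (TwoDomain.velocitySet b₂ (Am₂ m) y) := fun y hy =>
    hK₂.image_of_continuousOn
      (hb₂.comp (f := fun α => (y, α)) (by fun_prop) fun _ hα => ⟨hy, hα⟩)
  have h0₁ : ∀ y ∈ TwoDomain.closedOmega₁ k,
      (0 : TwoDomain.State k) ∈ TwoDomain.velocitySet b₁ (Am₁ m) y := fun y hy => by
    obtain ⟨δ, hδ, h⟩ := hHB₁.controllable y hy m
    exact h (Metric.mem_closedBall_self hδ.le)
  have h0₂ : ∀ y ∈ TwoDomain.closedOmega₂ k,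
      (0 : TwoDomain.State k) ∈ TwoDomain.velocitySet b₂ (Am₂ m) y := fun y hy => by
    obtain ⟨δ, hδ, h⟩ := hHB₂.controllable y hy m
    exact h (Metric.mem_closedBall_self hδ.le)
  obtain ⟨f, hfm, hfK, hf⟩ := TwoDomain.exists_measurable_regularControl hK₁ hK₂
    (Set.Nonempty.of_image ⟨_, h0₁ 0 (show (0 : ℝ) ≤ 0 from le_rfl)⟩)
    (Set.Nonempty.of_image ⟨_, h0₂ 0 (show (0 : ℝ) ≤ 0 from le_rfl)⟩) hb₁ hb₂
  have hkey : ∀ᵐ t ∂(volume.restrict (Ioo 0 T)), Xlim t ∈ TwoDomain.hyperplane k →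
      f (Xlim t, deriv Xlim t) ∈
        TwoDomain.regularControls b₁ b₂ (Am₁ m) (Am₂ m) (Xlim t) ∧
      TwoDomain.bH b₁ b₂ (Xlim t) (f (Xlim t, deriv Xlim t)) = deriv Xlim t := by
    filter_upwards [hαder, ae_restrict_mem measurableSet_Ioo, ae_restrict_of_ae
      (ae_hasDerivAt_eq_zero_of_eq_zero fun t => TwoDomain.lastCoord (Xlim t))]
      with t hder ht htan hH
    -- `deriv Xlim` is measurable everywhere, so it serves as the velocity fed to the selection `f`.
    replace hder := hder.differentiableAt.hasDerivAt
    have hH0 : TwoDomain.lastCoord (Xlim t) = 0 := hH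
    have hv : TwoDomain.lastCoord (deriv Xlim t) = 0 :=
      htan _ ((TwoDomain.lastCoordL k).hasFDerivAt.comp_hasDerivAt t hder) hH0
    obtain ⟨a, ha, hav⟩ := TwoDomain.exists_regularControl_of_approx (hB₁ _ hH0.ge)
      (hB₂ _ hH0.le) (h0₁ _ hH0.ge) (h0₂ _ hH0.le) hv fun ε hε =>
        TwoDomain.exists_mixture_of_tendstoUniformlyOn hK₁ hK₂ hb₁ hb₂
          (fun y hy => hHB₁.convex y hy m) (fun y hy => hHB₂.convex y hy m) hB₁ hB₂ hη_pos hη hX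
          hconv ht hH hder hv hε
    have := hf _ hH a ha
    rwa [hav] at this
  have hXc : ContinuousOn Xlim (Icc 0 T) := hL.continuousOn
  let S : Set ℝ := Icc 0 T ∩ Xlim ⁻¹' TwoDomain.hyperplane k
  have hS : MeasurableSet S := (hXc.preimage_isClosed_of_isClosed isClosed_Icc
    (isClosed_eq TwoDomain.continuous_lastCoord continuous_const)).measurableSet
  -- Off the hyperplane the given control is kept; on it, the regular control with the same velocity
  -- is used, so the trajectory is unchanged.
  let a : ℝ → TwoDomain.ExtCtrl d := S.piecewise (fun t => f (Xlim t, deriv Xlim t)) αlim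
  have haS : ∀ t ∈ Ioo 0 T, Xlim t ∈ TwoDomain.hyperplane k →
      a t = f (Xlim t, deriv Xlim t) := fun t ht hH =>
    piecewise_eq_of_mem _ _ _ ⟨Ioo_subset_Icc_self ht, hH⟩
  have haS' : ∀ t, Xlim t ∉ TwoDomain.hyperplane k → a t = αlim t := fun t hH =>
    piecewise_eq_of_notMem _ _ _ fun h => hH h.2
  have haK : ∀ᵐ t ∂(volume.restrict (Ioo 0 T)),
      a t ∈ TwoDomain.extControls (Am₁ m) (Am₂ m) := by
    filter_upwards [hαK, ae_restrict_mem measurableSet_Ioo] with t ht htI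
    by_cases hH : Xlim t ∈ TwoDomain.hyperplane k
    · rw [haS t htI hH]; exact hfK _
    · rwa [haS' t hH]
  obtain ⟨R, hR⟩ :=
    (hK₁.prod (hK₂.prod (isCompact_Icc (a := (0 : ℝ)) (b := 1)))).isBounded.exists_norm_le
  have ham : AEStronglyMeasurable a (volume.restrict (Ioo 0 T)) := by
    have hXm : AEMeasurable Xlim (volume.restrict (Ioo 0 T)) :=
      (hXc.mono Ioo_subset_Icc_self).aemeasurable measurableSet_Ioo
    have h1 : AEMeasurable (fun t => f (Xlim t, deriv Xlim t)) (volume.restrict (Ioo 0 T)) :=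
      hfm.comp_aemeasurable (hXm.prodMk (measurable_deriv Xlim).aemeasurable)
    exact AEStronglyMeasurable.piecewise hS h1.aestronglyMeasurable.restrict hαmem.1.restrict
  refine ⟨a, ⟨⟨L, hL⟩, memLp_top_of_bound ham R (haK.mono fun t ht => hR _ ht), haK, ?_, hX0⟩, ?_⟩
  · filter_upwards [hαder, hkey, ae_restrict_mem measurableSet_Ioo] with t hder hk htI
    by_cases hH : Xlim t ∈ TwoDomain.hyperplane k
    · have hH0 : TwoDomain.lastCoord (Xlim t) = 0 := hH
      have : TwoDomain.dynamic b₁ b₂ (Xlim t) (a t) = deriv Xlim t := by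
        rw [haS t htI hH, ← (hk hH).2]
        simp [TwoDomain.dynamic, hH0, (hk hH).2]
      simpa only [this] using hder.differentiableAt.hasDerivAt
    · simpa only [haS' t hH] using hder
  · filter_upwards [hkey, ae_restrict_mem measurableSet_Ioo] with t hk htI hH
    simp only [haS t htI hH]
    exact (hk hH).1
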